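/- Let $d\ge 2$ be an integer and $c\in(0,1]$. Let $\overrightarrow{\mathbb T}_d$ be the rooted homogeneous tree in which every vertex has $d+1$ neighbours, with all edges directed away from the root (so the root has $d+1$ children and every other vertex has $d$ children). For $q\in(0,1)$ with $dq<1$, consider the following frog model on $\overrightarrow{\mathbb T}_d$. Each vertex $v$ carries one particle, a random walk $(S^v_n)_{n\ge0}$ on $\overrightarrow{\mathbb T}_d$ started at $v$ whose every step goes to a uniformly chosen child of the current vertex, and a lifetime $\mathcal T_v$ with values in $\{0,1,2,\dots\}$ and $\mathbb P(\mathcal T_v\ge n)=c(dq)^n$ for all $n\ge1$; all walks and lifetimes are independent. At time $0$ only the particle at the root is active. A particle activated at time $s$ is at $S^v_n$ at time $s+n$ for $0\le n\le\mathcal T_v$, activates the inactive particles at the vertices that it visits, and is removed after $\mathcal T_v$ steps. The model survives if at every time there is at least one active particle. Let $\theta(d,c,q)$ be the probability of survival, and let $$q_c=q_c(d,c):=\inf\{q>0:\ \theta(d,c,q)>0\},$$ the infimum being over those $q$ for which the model is defined. Then $q_c$ is the unique $q\in(0,1)$ such that the series below converges and $$\sum_{k\ge1}c(dq)^k\prod_{i=1}^{k-1}(1-cq^i)=1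 .$$ Moreover $q_c\in(0,1/d)$. -/

import Mathlib

open scoped ENNReal

noncomputable section

namespace FrogModel

/-- Vertices of the rooted homogeneous tree in which every vertex has `d + 1` neighbours: the root
has `d + 1` children, every other vertex has one parent and `d` children. The vertex `node i l` is
reached from the root by going first to the child number `i` and then following the directions
listed in `l`, the most recent one at the head of `l`. -/
inductive Vertex (d : ℕ) : Type
  | root : Vertex d
  | node (i : Fin (d + 1)) (l : List (Fin d)) : Vertex d

/-- Randomness for one jump: a direction to be used at the root, and a direction to be used at any
other vertex. -/
abbrev Direction (d : ℕ) : Type := Fin (d + 1) × Fin d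

/-- The child of a vertex in a given direction (the edges point away from the root). When the
direction is uniform, this is a uniformly chosen child of the vertex. -/
def Vertex.child {d : ℕ} : Vertex d → Direction d → Vertex d
  | .root, x => .node x.1 []
  | .node i l, x => .node i (x.2 :: l)

/-- A realization: for each vertex, the lifetime of its particle and the directions of the
successive jumps of its particle. -/
abbrev Config (d : ℕ) : Type := Vertex d → ℕ × (ℕ → Direction d)

/-- The lifetime `𝒯_v`, the number of steps made by the particle of `v` once it is active. -/
def lifetime {d : ℕ} (ω : Config d) (v : Vertex d) : ℕ := (ω v).1

/-- The random walk `(S_n^v)` of the particle that starts from `v`. -/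
def walk {d : ℕ} (ω : Config d) (v : Vertex d) : ℕ → Vertex d
  | 0 => v
  | n + 1 => (walk ω v n).child ((ω v).2 n)

/-- `ActivatedAt ω v t`: the particle of `v` is activated at time `t`. At time `0` only the particle
of the root is active; a particle activated at time `s` visits, at the times `s + n` with `n` at
most its lifetime, the vertices of its walk and activates the particles there. As all jumps lead
away from the root, a vertex at distance `t` from the root can be visited at time `t` only, so the
time of the first visit need not be singled out. -/
inductive ActivatedAt {d : ℕ} (ω : Config d) : Vertex d → ℕ → Prop
  | root : ActivatedAt ω Vertex.root 0
  | visit (u : Vertex d) (s n : ℕ) (hu : ActivatedAt ω u s) (hn : n ≤ lifetime ω u) :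
      ActivatedAt ω (walk ω u n) (s + n)

/-- The particle of `v` is active at time `t`: it has been activated and its lifetime has not
elapsed. -/
def ActiveAt {d : ℕ} (ω : Config d) (v : Vertex d) (t : ℕ) : Prop :=
  ∃ s, ActivatedAt ω v s ∧ s ≤ t ∧ t < s + lifetime ω v

/-- Survival: at any time there is at least one active particle. -/
def Survives {d : ℕ} (ω : Config d) : Prop := ∀ t : ℕ, ∃ v : Vertex d, ActiveAt ω v t

/-- The law of the model in which the lifetimes have law `ν`: all lifetimes and all jumps are
independent, and the jumps are uniform. -/
def frogMeasure (d : ℕ) [NeZero d] (ν : PMF ℕ) : MeasureTheory.Measure (Config d) :=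
  MeasureTheory.Measure.infinitePi fun _ : Vertex d =>
    ν.toMeasure.prod
      (MeasureTheory.Measure.infinitePi fun _ : ℕ =>
        (PMF.uniformOfFintype (Direction d)).toMeasure)

/-- The probability of survival when the lifetimes have law `ν`. -/
def survivalProb (d : ℕ) [NeZero d] (ν : PMF ℕ) : ℝ≥0∞ :=
  frogMeasure d ν {ω | Survives ω}

/-- The lifetime law: a law on `ℕ = {0, 1, 2, …}` with `ℙ(𝒯 ≥ n) = c (d q) ^ n` for `n ≥ 1`. -/
def IsLifetimeLaw (d : ℕ) (c q : ℝ) (ν : PMF ℕ) : Prop :=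
  ∀ n : ℕ, 1 ≤ n → ν.toMeasure {m | n ≤ m} = ENNReal.ofReal (c * (d * q) ^ n)

/-- The lifetime law is unique. -/
theorem IsLifetimeLaw.unique {d : ℕ} {c q : ℝ} {ν ν' : PMF ℕ} (h : IsLifetimeLaw d c q ν)
    (h' : IsLifetimeLaw d c q ν') : ν = ν' := by
  have key : ∀ n : ℕ, ν.toMeasure {m | n ≤ m} = ν'.toMeasure {m | n ≤ m} := by
    intro n
    rcases Nat.eq_zero_or_pos n with rfl | hn
    · simp
    · rw [h n hn, h' n hn]
  refine PMF.toMeasure_injective (MeasureTheory.Measure.ext_of_Ici _ _ fun n => ?_)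
  exact key n

/-- The lifetime law exists for `0 < c ≤ 1` and `0 ≤ d q < 1`. -/
theorem exists_isLifetimeLaw {d : ℕ} {c q : ℝ} (hc : 0 < c) (hc' : c ≤ 1) (hq : 0 ≤ d * q)
    (hq' : d * q < 1) : ∃ ν : PMF ℕ, IsLifetimeLaw d c q ν := by
  set r : ℝ := d * q with hr
  let g : ℕ → ℝ := fun n => if n = 0 then 1 else c * r ^ n
  have g0 : g 0 = 1 := by simp [g]
  have gpos : ∀ n, 1 ≤ n → g n = c * r ^ n := fun n hn => by
    simp [g, Nat.one_le_iff_ne_zero.mp hn]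
  have hanti : ∀ n, 0 ≤ g n - g (n + 1) := by
    intro n
    rcases Nat.eq_zero_or_pos n with rfl | hn
    · rw [g0, gpos 1 le_rfl]
      nlinarith
    · rw [gpos n hn, gpos (n + 1) (by omega), pow_succ]
      have : 0 ≤ c * r ^ n := by positivity
      nlinarith
  have hsum : ∀ n, ∑ i ∈ Finset.range n, ENNReal.ofReal (g i - g (i + 1))
      = ENNReal.ofReal (1 - g n) := by
    intro n
    rw [← ENNReal.ofReal_sum_of_nonneg fun i _ => hanti i, Finset.sum_range_sub', g0]
  have hlim : Filter.Tendsto g Filter.atTop (nhds 0) := by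
    have h1 := (tendsto_pow_atTop_nhds_zero_of_lt_one hq hq').const_mul c
    rw [mul_zero] at h1
    refine h1.congr' ?_
    filter_upwards [Filter.eventually_ge_atTop 1] with n hn
    exact (gpos n hn).symm
  have hs : HasSum (fun n => ENNReal.ofReal (g n - g (n + 1))) 1 := by
    rw [ENNReal.hasSum_iff_tendsto_nat]
    simp_rw [hsum]
    have h2 := ENNReal.tendsto_ofReal (hlim.const_sub 1)
    simpa using h2
  obtain ⟨ν, hν⟩ : ∃ ν : PMF ℕ, ∀ n, ν n = ENNReal.ofReal (g n - g (n + 1)) :=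
    ⟨⟨_, hs⟩, fun _ => rfl⟩
  refine ⟨ν, fun n hn => ?_⟩
  have hg1 : 0 ≤ g n ∧ g n ≤ 1 := by
    rw [gpos n hn]
    have : r ^ n ≤ 1 := pow_le_one₀ hq hq'.le
    exact ⟨by positivity, by nlinarith [pow_nonneg hq n]⟩
  have hset : {m : ℕ | n ≤ m} = (↑(Finset.range n) : Set ℕ)ᶜ := by
    ext m
    simp
  rw [hset, MeasureTheory.prob_compl_eq_one_sub (Finset.measurableSet _),
    PMF.toMeasure_apply_finset]
  simp_rw [hν]
  rw [hsum, ← gpos n hn, ← ENNReal.ofReal_one, ← ENNReal.ofReal_sub 1 (by linarith [hg1.2])]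
  congr 1
  ring

/-- The critical parameter `q_c(d, c) = inf {q > 0 : θ(d, c, q) > 0}`, where `q` ranges over the
parameters in `(0, 1)` for which the model is defined and `θ(d, c, q)` is the probability of
survival. -/
def criticalParam (d : ℕ) [NeZero d] (c : ℝ) : ℝ :=
  sInf {q : ℝ | 0 < q ∧ q < 1 ∧ (∀ n : ℕ, 1 ≤ n → c * (d * q) ^ n < 1) ∧
    ∃ ν : PMF ℕ, IsLifetimeLaw d c q ν ∧ 0 < survivalProb d ν}

end FrogModel

end

/-! All walks move away from the root, so a vertex `y` can only be visited by particles of its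
ancestors, and `y` is activated exactly when every vertex on the path to it is visited by the
particle of an earlier vertex of that path. Splitting according to the closest ancestor whose
particle visits `y` yields a renewal structure (`act_iff`, `real_act_succ`): away from the root the
ancestor at distance `i` visits `y` with probability `c * q ^ i`, independently for different `i`,
so the activation probability over `n` generations is the renewal sequence `hitProb c q n` with
increments `gapProb c q` (`real_act_eq`). Multiplied by `d ^ n`, it is a renewal sequence whose
increments are the terms of the series in the theorem.

If the series has sum less than one, `d ^ n * hitProb c q n` is summable (`summable_of_renewal`),
and the expected number of activated vertices at distance `n` tends to zero, so there is extinction.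
If the sum exceeds one, then `d ^ N * hitProb c q N > 1` for some `N` (`exists_one_lt_of_renewal`),
and a supercritical branching structure embedded every `N` generations survives
(`exists_le_real_spread`).

The sum is continuous and strictly increasing while `d * q < 1`, vanishes at `0`, and exceeds one
close to `1 / d`. It therefore equals one at a single point, which separates the two regimes
(`criticalParam_eq`); for `d * q ≥ 1` the series diverges. -/

noncomputable section

namespace FrogModel

open MeasureTheory ProbabilityTheory

/-! ### Genealogy of the tree: ancestors, descendants, subtrees. -/

section Tree

variable {d : ℕ}

/-- The distance of a vertex to the root. -/
def Vertex.level : Vertex d → ℕ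
  | .root => 0
  | .node _ l => l.length + 1

/-- The parent of a vertex; by convention the root is its own parent. -/
def Vertex.parent : Vertex d → Vertex d
  | .root => .root
  | .node _ [] => .root
  | .node i (_ :: l) => .node i l

/-- The ancestor of a vertex `k` generations above it. -/
def anc (k : ℕ) (y : Vertex d) : Vertex d := Vertex.parent^[k] y

@[simp] lemma anc_zero (y : Vertex d) : anc 0 y = y := rfl

lemma anc_succ (k : ℕ) (y : Vertex d) : anc (k + 1) y = (anc k y).parent :=
  Function.iterate_succ_apply' _ _ _

lemma anc_anc (k j : ℕ) (y : Vertex d) : anc k (anc j y) = anc (k + j) y :=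
  (Function.iterate_add_apply _ _ _ _).symm

@[simp] lemma Vertex.parent_child (v : Vertex d) (x : Direction d) : (v.child x).parent = v := by
  cases v <;> rfl

lemma Vertex.level_parent (v : Vertex d) : v.parent.level = v.level - 1 := by
  rcases v with _ | ⟨i, _ | ⟨a, l⟩⟩ <;> rfl

@[simp] lemma Vertex.level_child (v : Vertex d) (x : Direction d) :
    (v.child x).level = v.level + 1 := by
  cases v <;> rfl

lemma level_anc (k : ℕ) (y : Vertex d) : (anc k y).level = y.level - k := by
  induction k with
  | zero => rfl
  | succ k ih => rw [anc_succ, Vertex.level_parent, ih]; omega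

lemma Vertex.eq_root_of_level {v : Vertex d} (h : v.level = 0) : v = .root := by
  cases v with
  | root => rfl
  | node i l => simp [Vertex.level] at h

lemma anc_level (y : Vertex d) : anc y.level y = .root :=
  Vertex.eq_root_of_level (by rw [level_anc]; omega)

instance : Countable (Vertex d) := by
  have : Function.Injective (fun v : Vertex d => match v with
      | .root => (none : Option (Fin (d + 1) × List (Fin d)))
      | .node i l => some (i, l)) := by
    rintro (_ | ⟨i, l⟩) (_ | ⟨j, m⟩) h <;> simp_all
  exact this.countable

lemma exists_eq_node_of_level {v : Vertex d} {n : ℕ} (h : v.level = n + 1) :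
    ∃ i, ∃ w : Fin n → Fin d, v = .node i (List.ofFn w) := by
  cases v with
  | root => simp [Vertex.level] at h
  | node i l =>
    obtain rfl : l.length = n := by simpa [Vertex.level] using h
    exact ⟨i, l.get, by rw [List.ofFn_get]⟩

/-- The descendant of the vertex `node i l` at distance `n` given by the directions `w`. -/
def descend {n : ℕ} (i : Fin (d + 1)) (l : List (Fin d)) (w : Fin n → Fin d) : Vertex d :=
  .node i (List.ofFn w ++ l)

lemma descend_injective {n : ℕ} (i : Fin (d + 1)) (l : List (Fin d)) :
    Function.Injective (descend (n := n) i l) := by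
  intro w w' h
  simpa [descend, List.ofFn_injective.eq_iff] using h

@[simp] lemma level_descend {n : ℕ} (i : Fin (d + 1)) (l : List (Fin d)) (w : Fin n → Fin d) :
    (descend i l w).level = (Vertex.node i l).level + n := by
  simp [descend, Vertex.level]; omega

lemma anc_length_append (i : Fin (d + 1)) (l m : List (Fin d)) :
    anc m.length (Vertex.node i (m ++ l)) = .node i l := by
  induction m with
  | nil => rfl
  | cons a m ih => exact ih

@[simp] lemma anc_descend {n : ℕ} (i : Fin (d + 1)) (l : List (Fin d)) (w : Fin n → Fin d) :
    anc n (descend i l w) = .node i l := by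
  have := anc_length_append i l (List.ofFn w)
  rwa [List.length_ofFn] at this

/-- The vertices of the subtree rooted at `x`. -/
def subtree (x : Vertex d) : Set (Vertex d) :=
  {z | x.level ≤ z.level ∧ anc (z.level - x.level) z = x}

lemma disjoint_subtree {x y : Vertex d} (hl : x.level = y.level) (hne : x ≠ y) :
    Disjoint (subtree x) (subtree y) := by
  rw [Set.disjoint_left]
  rintro z ⟨-, hx⟩ ⟨-, hy⟩
  exact hne (by rw [← hx, ← hy, hl])

lemma subtree_subset {x y : Vertex d} (h : y ∈ subtree x) : subtree y ⊆ subtree x := by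
  rintro z ⟨h1, h2⟩
  obtain ⟨h3, h4⟩ := h
  refine ⟨h3.trans h1, ?_⟩
  calc anc (z.level - x.level) z = anc (y.level - x.level) (anc (z.level - y.level) z) := by
        rw [anc_anc]; congr 1; omega
    _ = x := by rw [h2, h4]

end Tree

/-! ### Activation described along ancestral lines. -/

section Paths

variable {d : ℕ}

@[simp] lemma level_walk (ω : Config d) (u : Vertex d) (n : ℕ) :
    (walk ω u n).level = u.level + n := by
  induction n with
  | zero => rfl
  | succ n ih => simp [walk, ih, add_assoc]

lemma anc_walk (ω : Config d) (u : Vertex d) {n j : ℕ} (h : j ≤ n) :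
    anc j (walk ω u n) = walk ω u (n - j) := by
  induction j with
  | zero => rfl
  | succ j ih =>
    rw [anc_succ, ih (by omega), show n - j = n - (j + 1) + 1 by omega, walk,
      Vertex.parent_child]

/-- The particle of the ancestor `anc k y` visits `y` if it is activated. -/
def Reach (ω : Config d) (y : Vertex d) (k : ℕ) : Prop :=
  k ≤ lifetime ω (anc k y) ∧ walk ω (anc k y) k = y

lemma Reach.anc {ω : Config d} {y : Vertex d} {k : ℕ} (h : Reach ω y k) {j : ℕ} (hj : j ≤ k) :
    Reach ω (anc j y) (k - j) := by
  have e : FrogModel.anc (k - j) (FrogModel.anc j y) = FrogModel.anc k y := by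
    rw [anc_anc]; congr 1; omega
  refine ⟨by rw [e]; exact (Nat.sub_le _ _).trans h.1, ?_⟩
  rw [e, ← anc_walk ω _ hj, h.2]

/-- The vertex `y` is activated by the process started from the activation of `anc n y`. -/
def Act (ω : Config d) (n : ℕ) (y : Vertex d) : Prop :=
  ∀ j < n, ∃ k, 1 ≤ k ∧ j + k ≤ n ∧ Reach ω (anc j y) k

lemma Act.anc {ω : Config d} {n : ℕ} {y : Vertex d} (h : Act ω n y) (j : ℕ) :
    Act ω (n - j) (anc j y) := by
  intro i hi
  obtain ⟨k, hk, hk', hr⟩ := h (i + j) (by omega)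
  exact ⟨k, hk, by omega, by rwa [anc_anc]⟩

/-- The particle that goes from `anc k y` to `y` also visits every vertex in between. -/
lemma act_of_reach {ω : Config d} {n k : ℕ} {y : Vertex d} (hkn : k ≤ n)
    (h : Act ω (n - k) (anc k y)) (hr : Reach ω y k) : Act ω n y := by
  intro j hj
  rcases lt_or_ge j k with hjk | hjk
  · exact ⟨k - j, by omega, by omega, hr.anc hjk.le⟩
  · obtain ⟨i, hi, hi', hr'⟩ := h (j - k) (by omega)
    rw [anc_anc, Nat.sub_add_cancel hjk] at hr'
    exact ⟨i, hi, by omega, hr'⟩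

/-- Decomposition according to the closest ancestor whose particle visits `y`. -/
lemma act_iff {ω : Config d} {n : ℕ} (hn : 1 ≤ n) {y : Vertex d} :
    Act ω n y ↔ ∃ k ∈ Finset.Icc 1 n, Act ω (n - k) (anc k y) ∧ Reach ω y k ∧
      ∀ j ∈ Finset.Ico 1 k, ¬ Reach ω y j := by
  classical
  constructor
  · intro h
    have hex : ∃ k, 1 ≤ k ∧ k ≤ n ∧ Reach ω y k := by simpa using h 0 (by omega)
    have hs := Nat.find_spec hex
    -- Activation passes to every vertex of the path, so the closest visitor is itself activated and
    -- no choice among visitors is needed.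
    refine ⟨Nat.find hex, Finset.mem_Icc.2 ⟨hs.1, hs.2.1⟩, h.anc _, hs.2.2, ?_⟩
    intro j hj hr
    rw [Finset.mem_Ico] at hj
    exact Nat.find_min hex hj.2 ⟨hj.1, by omega, hr⟩
  · rintro ⟨k, hk, ha, hr, -⟩
    exact act_of_reach (Finset.mem_Icc.1 hk).2 ha hr

lemma ActivatedAt.level_eq {ω : Config d} {y : Vertex d} {t : ℕ} (h : ActivatedAt ω y t) :
    y.level = t := by
  induction h with
  | root => rfl
  | visit u s n hu hn ih => simp [ih]

lemma ActivatedAt.act {ω : Config d} {y : Vertex d} {t : ℕ} (h : ActivatedAt ω y t) :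
    Act ω t y := by
  induction h with
  | root => intro j hj; omega
  | visit u s n hu hn ih =>
    have e : FrogModel.anc n (walk ω u n) = u := by rw [anc_walk ω u le_rfl]; simp [walk]
    refine act_of_reach (k := n) (by omega) ?_ ⟨by rwa [e], by rw [e]⟩
    rwa [e, Nat.add_sub_cancel]

lemma Act.activatedAt {ω : Config d} {n : ℕ} : ∀ {y : Vertex d} {s : ℕ}, Act ω n y →
    ActivatedAt ω (FrogModel.anc n y) s → ActivatedAt ω y (s + n) := by
  induction n using Nat.strong_induction_on with
  | _ n ih =>
    intro y s h hs
    rcases Nat.eq_zero_or_pos n with rfl | hn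
    · exact hs
    obtain ⟨k, hk, ha, hr, -⟩ := (act_iff hn).1 h
    rw [Finset.mem_Icc] at hk
    have h1 := ih (n - k) (by omega) (s := s) ha
      (by rwa [anc_anc, Nat.sub_add_cancel hk.2])
    have h2 := ActivatedAt.visit _ _ k h1 hr.1
    rw [hr.2] at h2
    convert h2 using 1
    omega

lemma activatedAt_iff {ω : Config d} {y : Vertex d} {t : ℕ} :
    ActivatedAt ω y t ↔ y.level = t ∧ Act ω t y := by
  refine ⟨fun h => ⟨h.level_eq, h.act⟩, ?_⟩
  rintro ⟨rfl, h⟩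
  have := h.activatedAt (s := 0) (by rw [anc_level]; exact .root)
  rwa [zero_add] at this

/-- Ancestors of activated vertices are activated; hence the events decrease in time and survival is
their decreasing limit. -/
lemma exists_activatedAt_of_le {ω : Config d} {s t : ℕ} (hst : s ≤ t)
    (h : ∃ y, ActivatedAt ω y t) : ∃ y, ActivatedAt ω y s := by
  obtain ⟨y, hy⟩ := h
  refine ⟨anc (t - s) y, activatedAt_iff.2 ⟨?_, ?_⟩⟩
  · rw [level_anc, hy.level_eq]; omega
  · have := hy.act.anc (t - s)
    rwa [Nat.sub_sub_self hst] at this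

lemma survives_iff {ω : Config d} : Survives ω ↔ ∀ t, ∃ y, ActivatedAt ω y t := by
  constructor
  · intro h t
    obtain ⟨v, s, hs, hst, ht⟩ := h t
    exact ⟨_, by simpa [Nat.add_sub_cancel' hst] using ActivatedAt.visit v s (t - s) hs (by omega)⟩
  · intro h t
    -- Time `t + 1` rather than `t`: the visitor of a vertex at that distance makes a step after
    -- time `t`, so it is still active at time `t`.
    obtain ⟨y, hy⟩ := h (t + 1)
    obtain ⟨k, hk, ha, hr, -⟩ := (act_iff (by omega)).1 hy.act
    rw [Finset.mem_Icc] at hk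
    refine ⟨anc k y, t + 1 - k, activatedAt_iff.2 ⟨?_, ha⟩, by omega, ?_⟩
    · rw [level_anc, hy.level_eq]
    · have := hr.1
      omega

end Paths

/-! ### Which particles an event depends on. -/

section Measurability

variable {d : ℕ}

/-- The information carried by the particles of the vertices in `S`. -/
@[reducible] def sigmaOf (S : Set (Vertex d)) : MeasurableSpace (Config d) :=
  ⨆ v ∈ S, MeasurableSpace.comap (fun ω : Config d => ω v) inferInstance

lemma comap_eval_le (v : Vertex d) :
    MeasurableSpace.comap (fun ω : Config d => ω v) inferInstance ≤
      (inferInstance : MeasurableSpace (Config d)) :=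
  (measurable_pi_apply v).comap_le

lemma sigmaOf_le (S : Set (Vertex d)) :
    sigmaOf S ≤ (inferInstance : MeasurableSpace (Config d)) :=
  iSup₂_le fun v _ => comap_eval_le v

lemma sigmaOf_mono {S T : Set (Vertex d)} (h : S ⊆ T) : sigmaOf S ≤ sigmaOf T :=
  biSup_mono h

lemma measurableSet_sigmaOf_eval {S : Set (Vertex d)} {v : Vertex d} (hv : v ∈ S)
    {R : Set (ℕ × (ℕ → Direction d))} (hR : MeasurableSet R) :
    MeasurableSet[sigmaOf S] {ω : Config d | ω v ∈ R} :=
  (le_iSup₂_of_le (f := fun v (_ : v ∈ S) =>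
    MeasurableSpace.comap (fun ω : Config d => ω v) inferInstance) v hv le_rfl) _ ⟨R, hR, rfl⟩

/-- The directions that lead from the parent of `z` to `z`. -/
def stepSet (z : Vertex d) : Set (Direction d) := {x | z.parent.child x = z}

/-- The lifetimes and directions with which the particle of `anc k y` visits `y`. -/
def reachSet (y : Vertex d) (k : ℕ) : Set (ℕ × (ℕ → Direction d)) :=
  {m | k ≤ m} ×ˢ ((Finset.range k : Set ℕ).pi fun j => stepSet (anc (k - (j + 1)) y))

lemma measurableSet_reachSet (y : Vertex d) (k : ℕ) : MeasurableSet (reachSet y k) :=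
  (MeasurableSet.of_discrete).prod
    (MeasurableSet.pi (Finset.countable_toSet _) fun _ _ => MeasurableSet.of_discrete)

lemma reach_iff {ω : Config d} {y : Vertex d} {k : ℕ} :
    Reach ω y k ↔ ω (anc k y) ∈ reachSet y k := by
  have key : walk ω (anc k y) k = y ↔
      ∀ j < k, (ω (anc k y)).2 j ∈ stepSet (anc (k - (j + 1)) y) := by
    constructor
    · intro h j hj
      have h1 : ∀ i ≤ k, anc (k - i) y = walk ω (anc k y) i := by
        intro i hi
        have := anc_walk ω (anc k y) (Nat.sub_le k i)
        rwa [h, Nat.sub_sub_self hi] at this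
      simp only [stepSet, Set.mem_ofPred_eq]
      rw [h1 (j + 1) hj]
      simp [walk]
    · intro h
      have h1 : ∀ i ≤ k, walk ω (anc k y) i = anc (k - i) y := by
        intro i
        induction i with
        | zero => intro _; rfl
        | succ i ih =>
          intro hi
          have h2 := h i hi
          simp only [stepSet, Set.mem_ofPred_eq, ← anc_succ] at h2
          rw [show k - (i + 1) + 1 = k - i by omega] at h2
          rw [walk, ih (by omega), h2]
      simpa using h1 k le_rfl
  simp [Reach, reachSet, key, lifetime, Set.mem_pi]

lemma measurableSet_reach {S : Set (Vertex d)} {y : Vertex d} {k : ℕ} (h : anc k y ∈ S) :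
    MeasurableSet[sigmaOf S] {ω | Reach ω y k} := by
  simp only [reach_iff]
  exact measurableSet_sigmaOf_eval h (measurableSet_reachSet y k)

lemma measurableSet_act {S : Set (Vertex d)} {y : Vertex d} {n : ℕ}
    (h : ∀ k, 1 ≤ k → k ≤ n → anc k y ∈ S) :
    MeasurableSet[sigmaOf S] {ω | Act ω n y} := by
  have : {ω : Config d | Act ω n y} = ⋂ j ∈ Finset.range n, ⋃ k ∈ Finset.Icc 1 (n - j),
      {ω | Reach ω (anc j y) k} := by
    ext ω
    simp only [Act, Set.mem_ofPred_eq, Set.mem_iInter, Set.mem_iUnion, Finset.mem_range,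
      Finset.mem_Icc, exists_prop]
    refine forall₂_congr fun j hj => exists_congr fun k => ?_
    rw [and_assoc]
    refine and_congr_right fun _ => and_congr_left fun _ => by omega
  rw [this]
  refine Finset.measurableSet_biInter _ fun j hj => Finset.measurableSet_biUnion _ fun k hk => ?_
  rw [Finset.mem_range] at hj
  rw [Finset.mem_Icc] at hk
  exact measurableSet_reach (by rw [anc_anc]; exact h _ (by omega) (by omega))

end Measurability

/-! ### Independence over disjoint vertex sets, and visit probabilities. -/

section Independence

variable {d : ℕ} [NeZero d] {ν : PMF ℕ}

instance : IsProbabilityMeasure (frogMeasure d ν) := by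
  unfold frogMeasure; infer_instance

lemma indep_sigmaOf {S T : Set (Vertex d)} (h : Disjoint S T) :
    Indep (sigmaOf S) (sigmaOf T) (frogMeasure d ν) := by
  refine indep_iSup_of_disjoint comap_eval_le ?_ h
  rw [← iIndepFun_iff_iIndep]
  exact iIndepFun_infinitePi (X := fun _ x => x) fun _ => measurable_id

lemma real_inter_of_disjoint {S T : Set (Vertex d)} (h : Disjoint S T) {A B : Set (Config d)}
    (hA : MeasurableSet[sigmaOf S] A) (hB : MeasurableSet[sigmaOf T] B) :
    (frogMeasure d ν).real (A ∩ B) = (frogMeasure d ν).real A * (frogMeasure d ν).real B := by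
  simp only [measureReal_def]
  rw [(Indep_iff _ _ _).1 (indep_sigmaOf h) A B hA hB, ENNReal.toReal_mul]

/-- The uniform measure on directions. -/
def unif (d : ℕ) [NeZero d] : Measure (Direction d) :=
  (PMF.uniformOfFintype (Direction d)).toMeasure

instance : IsProbabilityMeasure (unif d) := by
  unfold unif; infer_instance

lemma unif_stepSet {z : Vertex d} (hz : 2 ≤ z.level) : unif d (stepSet z) = (d : ℝ≥0∞)⁻¹ := by
  classical
  rcases z with _ | ⟨i, _ | ⟨a, l⟩⟩
  · simp [Vertex.level] at hz
  · simp [Vertex.level] at hz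
  have e : stepSet (Vertex.node i (a :: l)) =
      ((Finset.univ ×ˢ {a} : Finset (Direction d)) : Set (Direction d)) := by
    ext x
    rcases x with ⟨x, x'⟩
    simp [stepSet, Vertex.parent, Vertex.child, eq_comm]
  rw [e, unif, PMF.toMeasure_apply_finset]
  have hd : (d : ℝ≥0∞) ≠ 0 := by exact_mod_cast NeZero.ne d
  simp only [PMF.uniformOfFintype_apply, Finset.sum_const, Finset.card_product, Finset.card_univ,
    Fintype.card_fin, Finset.card_singleton, mul_one, nsmul_eq_mul, Fintype.card_prod,
    Nat.cast_mul]
  rw [ENNReal.mul_inv (Or.inr (by simp)) (Or.inr hd), ← mul_assoc,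
    ENNReal.mul_inv_cancel (by simp) (by simp), one_mul]

lemma unif_stepSet_of_level_one {z : Vertex d} (hz : z.level = 1) :
    unif d (stepSet z) = ((d + 1 : ℕ) : ℝ≥0∞)⁻¹ := by
  classical
  rcases z with _ | ⟨i, _ | ⟨a, l⟩⟩
  · simp [Vertex.level] at hz
  · have e : stepSet (Vertex.node i []) =
        (({i} ×ˢ Finset.univ : Finset (Direction d)) : Set (Direction d)) := by
      ext x
      rcases x with ⟨x, x'⟩
      simp [stepSet, Vertex.parent, Vertex.child, eq_comm]
    rw [e, unif, PMF.toMeasure_apply_finset]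
    have hd : (d : ℝ≥0∞) ≠ 0 := by exact_mod_cast NeZero.ne d
    simp only [PMF.uniformOfFintype_apply, Finset.sum_const, Finset.card_product, Finset.card_univ,
      Fintype.card_fin, Finset.card_singleton, one_mul, nsmul_eq_mul, Fintype.card_prod,
      Nat.cast_mul]
    rw [ENNReal.mul_inv (Or.inr (by simp)) (Or.inr hd), mul_comm, mul_assoc,
      ENNReal.inv_mul_cancel hd (by simp), mul_one]
  · simp [Vertex.level] at hz

lemma unif_stepSet_le (z : Vertex d) : unif d (stepSet z) ≤ (d : ℝ≥0∞)⁻¹ := by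
  rcases lt_or_ge z.level 2 with h | h
  · rcases Nat.lt_or_ge z.level 1 with h0 | h1
    · obtain rfl := Vertex.eq_root_of_level (show z.level = 0 by omega)
      have : stepSet (Vertex.root : Vertex d) = ∅ := by
        ext x
        simp [stepSet, Vertex.parent, Vertex.child]
      simp [this]
    · rw [unif_stepSet_of_level_one (by omega)]
      exact ENNReal.inv_le_inv.2 (by exact_mod_cast Nat.le_succ d)
  · exact (unif_stepSet h).le

lemma measure_reach (y : Vertex d) (k : ℕ) :
    frogMeasure d ν {ω | Reach ω y k} =
      ν.toMeasure {m | k ≤ m} * ∏ j ∈ Finset.range k, unif d (stepSet (anc (k - (j + 1)) y)) := by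
  have h1 : {ω : Config d | Reach ω y k} = (fun ω => ω (anc k y)) ⁻¹' reachSet y k := by
    ext ω; exact reach_iff
  have h2 : Measurable fun ω : Config d => ω (anc k y) := measurable_pi_apply _
  rw [h1, ← Measure.map_apply h2 (measurableSet_reachSet y k), frogMeasure,
    Measure.infinitePi_map_eval, reachSet, Measure.prod_prod]
  congr 1
  exact Measure.infinitePi_pi _ fun _ _ => MeasurableSet.of_discrete

variable {c q : ℝ}

lemma ofReal_mul_inv_pow (hq : 0 ≤ q) (hc : 0 ≤ c) (k : ℕ) :
    ENNReal.ofReal (c * (d * q) ^ k) * (d : ℝ≥0∞)⁻¹ ^ k = ENNReal.ofReal (c * q ^ k) := by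
  have hd : (0 : ℝ) < d := by exact_mod_cast Nat.pos_of_ne_zero (NeZero.ne d)
  rw [← ENNReal.ofReal_natCast d, ← ENNReal.ofReal_inv_of_pos hd,
    ← ENNReal.ofReal_pow (by positivity), ← ENNReal.ofReal_mul (by positivity)]
  rw [mul_assoc, ← mul_pow]
  congr 3
  field_simp

/-- The factor `d ^ k` of the lifetime tail cancels `k` steps of probability `1 / d`. Only a bound
holds in general, because a step out of the root has probability `1 / (d + 1)`; equality needs a
visitor other than the root. -/
lemma real_reach_le (hν : IsLifetimeLaw d c q ν) (hq : 0 ≤ q) (hc : 0 ≤ c) (y : Vertex d) {k : ℕ}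
    (hk : 1 ≤ k) : (frogMeasure d ν).real {ω | Reach ω y k} ≤ c * q ^ k := by
  refine ENNReal.toReal_le_of_le_ofReal (by positivity) ?_
  rw [measure_reach, hν k hk, ← ofReal_mul_inv_pow (d := d) hq hc k]
  gcongr
  calc _ ≤ ∏ _j ∈ Finset.range k, (d : ℝ≥0∞)⁻¹ := Finset.prod_le_prod' fun j _ => unif_stepSet_le _
    _ = _ := by simp

lemma real_reach_eq (hν : IsLifetimeLaw d c q ν) (hq : 0 ≤ q) (hc : 0 ≤ c) {y : Vertex d} {k : ℕ}
    (hk : 1 ≤ k) (hy : k < y.level) :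
    (frogMeasure d ν).real {ω | Reach ω y k} = c * q ^ k := by
  rw [measureReal_def, measure_reach, hν k hk,
    Finset.prod_congr rfl (g := fun _ => (d : ℝ≥0∞)⁻¹) fun j hj => unif_stepSet ?_]
  · rw [Finset.prod_const, Finset.card_range, ofReal_mul_inv_pow hq hc,
      ENNReal.toReal_ofReal (by positivity)]
  · rw [Finset.mem_range] at hj
    rw [level_anc]
    omega

lemma real_reach_one_pos (hν : IsLifetimeLaw d c q ν) (hq : 0 < q) (hc : 0 < c) {y : Vertex d}
    (hy : y.level = 1) : 0 < (frogMeasure d ν).real {ω | Reach ω y 1} := by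
  have hd : (0 : ℝ) < d := by exact_mod_cast Nat.pos_of_ne_zero (NeZero.ne d)
  rw [measureReal_def, measure_reach, hν 1 le_rfl]
  refine ENNReal.toReal_pos (mul_ne_zero ?_ ?_) (ENNReal.mul_ne_top ENNReal.ofReal_ne_top ?_)
  · simp only [ne_eq, ENNReal.ofReal_eq_zero, not_le]
    positivity
  · simp [unif_stepSet_of_level_one hy]
  · simp

end Independence

/-- The probability that a vertex is visited by the particle of its ancestor `k + 1` generations
above it, and by the particle of no closer ancestor. -/
def gapProb (c q : ℝ) (k : ℕ) : ℝ := c * q ^ (k + 1) * ∏ i ∈ Finset.Icc 1 k, (1 - c * q ^ i)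

/-- The renewal sequence with increments `gapProb c q`. -/
def hitProb (c q : ℝ) : ℕ → ℝ
  | 0 => 1
  | n + 1 => ∑ k : Fin (n + 1), hitProb c q (n - k) * gapProb c q k
decreasing_by omega

lemma hitProb_zero (c q : ℝ) : hitProb c q 0 = 1 := by rw [hitProb]

lemma hitProb_succ (c q : ℝ) (n : ℕ) :
    hitProb c q (n + 1) = ∑ k ∈ Finset.range (n + 1), hitProb c q (n - k) * gapProb c q k := by
  rw [hitProb, Finset.sum_range fun k => hitProb c q (n - k) * gapProb c q k]

/-! ### The renewal equation for activation probabilities. -/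

section Renewal

variable {d : ℕ}

lemma measurableSet_forall_not_reach {S : Set (Vertex d)} {y : Vertex d} {k : ℕ}
    (h : ∀ j, 1 ≤ j → j ≤ k → anc j y ∈ S) :
    MeasurableSet[sigmaOf S] {ω | ∀ j ∈ Finset.Icc 1 k, ¬ Reach ω y j} := by
  have : {ω : Config d | ∀ j ∈ Finset.Icc 1 k, ¬ Reach ω y j} =
      ⋂ j ∈ Finset.Icc 1 k, {ω | Reach ω y j}ᶜ := by
    ext ω
    simp
  rw [this]
  refine Finset.measurableSet_biInter _ fun j hj => ?_
  rw [Finset.mem_Icc] at hj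
  exact (measurableSet_reach (h j hj.1 hj.2)).compl

variable [NeZero d] {ν : PMF ℕ}

lemma real_compl_reach (y : Vertex d) (k : ℕ) :
    (frogMeasure d ν).real {ω | Reach ω y k}ᶜ = 1 - (frogMeasure d ν).real {ω | Reach ω y k} :=
  probReal_compl_eq_one_sub
    (sigmaOf_le _ _ (measurableSet_reach (S := Set.univ) (Set.mem_univ _)))

lemma real_forall_not_reach {y : Vertex d} {k : ℕ} (hk : k ≤ y.level) :
    (frogMeasure d ν).real {ω | ∀ j ∈ Finset.Icc 1 k, ¬ Reach ω y j} =
      ∏ j ∈ Finset.Icc 1 k, (1 - (frogMeasure d ν).real {ω | Reach ω y j}) := by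
  induction k with
  | zero => simp
  | succ k ih =>
    have e : {ω : Config d | ∀ j ∈ Finset.Icc 1 (k + 1), ¬ Reach ω y j} =
        {ω | ∀ j ∈ Finset.Icc 1 k, ¬ Reach ω y j} ∩ {ω | Reach ω y (k + 1)}ᶜ := by
      ext ω
      simp [← Finset.insert_Icc_right_eq_Icc_add_one (show 1 ≤ k + 1 by omega), and_comm]
    rw [e, real_inter_of_disjoint (S := {v | y.level < v.level + (k + 1)})
        (T := {v | v.level + (k + 1) = y.level}), ih (by omega), real_compl_reach,
      Finset.prod_Icc_succ_top (by omega)]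
    · rw [Set.disjoint_left]
      intro v hv hv'
      simp only [Set.mem_ofPred_eq] at hv hv'
      omega
    · refine measurableSet_forall_not_reach fun j hj hj' => ?_
      simp only [Set.mem_ofPred_eq, level_anc]
      omega
    · refine (measurableSet_reach ?_).compl
      simp only [Set.mem_ofPred_eq, level_anc]
      omega

/-- For the closest visitor at distance `k + 1`, the three events involve only particles above that
ancestor, its own particle, and particles below it, so they are independent; different `k` give
disjoint events. -/
lemma real_act_succ {y : Vertex d} {n : ℕ} (hn : n + 1 ≤ y.level) :
    (frogMeasure d ν).real {ω | Act ω (n + 1) y} =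
      ∑ k ∈ Finset.range (n + 1), (frogMeasure d ν).real {ω | Act ω (n - k) (anc (k + 1) y)} *
        ((frogMeasure d ν).real {ω | Reach ω y (k + 1)} *
          ∏ j ∈ Finset.Icc 1 k, (1 - (frogMeasure d ν).real {ω | Reach ω y j})) := by
  have e : {ω : Config d | Act ω (n + 1) y} = ⋃ k ∈ Finset.range (n + 1),
      ({ω | Act ω (n - k) (anc (k + 1) y)} ∩
        ({ω | Reach ω y (k + 1)} ∩ {ω | ∀ j ∈ Finset.Icc 1 k, ¬ Reach ω y j})) := by
    ext ω
    simp only [Set.mem_ofPred_eq, act_iff (Nat.le_add_left 1 n), Set.mem_iUnion, Set.mem_inter_iff,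
      Finset.mem_range, Finset.mem_Icc, Finset.mem_Ico]
    constructor
    · rintro ⟨k, hk, ha, hr, hn⟩
      obtain ⟨k, rfl⟩ : ∃ i, k = i + 1 := ⟨k - 1, by omega⟩
      exact ⟨k, by omega, by rwa [Nat.add_sub_add_right] at ha, hr, fun j hj => hn j (by omega)⟩
    · rintro ⟨k, hk, ha, hr, hn⟩
      exact ⟨k + 1, by omega, by rwa [Nat.add_sub_add_right], hr, fun j hj => hn j (by omega)⟩
  have mR : ∀ k ≤ n, MeasurableSet[sigmaOf {v | v.level + (k + 1) = y.level}]
      {ω : Config d | Reach ω y (k + 1)} := fun k hk => measurableSet_reach (by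
    simp only [Set.mem_ofPred_eq, level_anc]
    omega)
  have mN : ∀ k ≤ n, MeasurableSet[sigmaOf {v | y.level < v.level + (k + 1)}]
      {ω : Config d | ∀ j ∈ Finset.Icc 1 k, ¬ Reach ω y j} := fun k hk =>
    measurableSet_forall_not_reach fun j hj hj' => by
      simp only [Set.mem_ofPred_eq, level_anc]
      omega
  have mA : ∀ k ≤ n, MeasurableSet[sigmaOf {v | v.level + (k + 1) < y.level}]
      {ω : Config d | Act ω (n - k) (anc (k + 1) y)} := fun k hk =>
    measurableSet_act fun j hj hj' => by
      simp only [Set.mem_ofPred_eq, level_anc]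
      omega
  rw [e, measureReal_biUnion_finset]
  · refine Finset.sum_congr rfl fun k hk => ?_
    rw [Finset.mem_range] at hk
    rw [real_inter_of_disjoint (T := {v | y.level ≤ v.level + (k + 1)}) ?_ (mA k (by omega))
        (((sigmaOf_mono ?_ _ (mR k (by omega)))).inter (sigmaOf_mono ?_ _ (mN k (by omega)))),
      real_inter_of_disjoint ?_ (mR k (by omega)) (mN k (by omega)),
      real_forall_not_reach (by omega)]
    · rw [Set.disjoint_left]
      intro v hv hv'
      simp only [Set.mem_ofPred_eq] at hv hv'
      omega
    · rw [Set.disjoint_left]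
      intro v hv hv'
      simp only [Set.mem_ofPred_eq] at hv hv'
      omega
    · intro v hv
      simp only [Set.mem_ofPred_eq] at hv ⊢
      omega
    · intro v hv
      simp only [Set.mem_ofPred_eq] at hv ⊢
      omega
  · intro k _ j _ hkj
    simp only [Function.onFun]
    rw [Set.disjoint_left]
    rintro ω ⟨-, h1, h2⟩ ⟨-, h3, h4⟩
    rcases lt_or_gt_of_ne hkj with h | h
    · exact h4 (k + 1) (Finset.mem_Icc.2 ⟨by omega, by omega⟩) h1
    · exact h2 (j + 1) (Finset.mem_Icc.2 ⟨by omega, by omega⟩) h3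
  · intro k hk
    rw [Finset.mem_range] at hk
    exact (sigmaOf_le _ _ (mA k (by omega))).inter
      ((sigmaOf_le _ _ (mR k (by omega))).inter (sigmaOf_le _ _ (mN k (by omega))))

variable {c q : ℝ}

lemma real_act_eq (hν : IsLifetimeLaw d c q ν) (hq : 0 ≤ q) (hc : 0 ≤ c) {n : ℕ} :
    ∀ {y : Vertex d}, n < y.level →
      (frogMeasure d ν).real {ω | Act ω n y} = hitProb c q n := by
  induction n using Nat.strong_induction_on with
  | _ n ih =>
    intro y hy
    rcases n with _ | n
    · simp [Act, hitProb_zero]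
    rw [real_act_succ hy.le, hitProb_succ]
    refine Finset.sum_congr rfl fun k hk => ?_
    rw [Finset.mem_range] at hk
    rw [ih (n - k) (by omega) (by rw [level_anc]; omega),
      real_reach_eq hν hq hc (by omega) (by omega), gapProb]
    congr 2
    refine Finset.prod_congr rfl fun j hj => ?_
    rw [Finset.mem_Icc] at hj
    rw [real_reach_eq hν hq hc hj.1 (by omega)]

lemma real_act_le (hν : IsLifetimeLaw d c q ν) (hq : 0 ≤ q) (hc : 0 ≤ c) {n : ℕ} :
    ∀ {y : Vertex d}, n ≤ y.level →
      (frogMeasure d ν).real {ω | Act ω n y} ≤ hitProb c q n := by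
  induction n using Nat.strong_induction_on with
  | _ n ih =>
    intro y hy
    rcases n with _ | n
    · simp [Act, hitProb_zero]
    rw [real_act_succ hy, hitProb_succ]
    refine Finset.sum_le_sum fun k hk => ?_
    rw [Finset.mem_range] at hk
    have h0 := ih (n - k) (by omega) (y := anc (k + 1) y) (by rw [level_anc]; omega)
    -- These factors need equality, since an upper bound on visit probabilities would point the
    -- wrong way. Here `j ≤ k ≤ n < y.level`, so the ancestors concerned are not the root.
    have hp : ∏ j ∈ Finset.Icc 1 k, (1 - (frogMeasure d ν).real {ω | Reach ω y j}) =
        ∏ j ∈ Finset.Icc 1 k, (1 - c * q ^ j) := by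
      refine Finset.prod_congr rfl fun j hj => ?_
      rw [Finset.mem_Icc] at hj
      rw [real_reach_eq hν hq hc hj.1 (by omega)]
    have hp0 : 0 ≤ ∏ j ∈ Finset.Icc 1 k, (1 - c * q ^ j) := by
      rw [← hp]
      exact Finset.prod_nonneg fun j _ => sub_nonneg.2 measureReal_le_one
    rw [hp, gapProb]
    have h1 := real_reach_le hν hq hc y (k := k + 1) (by omega)
    have h2 : 0 ≤ hitProb c q (n - k) := measureReal_nonneg.trans h0
    gcongr

end Renewal

/-! ### The embedded branching structure. -/

section Growth

variable {d : ℕ}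

/-- A Bonferroni bound. In each overlap only one of the two events `A w`, `A w'` is kept, so nothing
has to be known about their joint law: in the application they share particles and are dependent. -/
lemma le_measureReal_iUnion_inter {Ω W : Type*} [Fintype W] {mΩ : MeasurableSpace Ω}
    {P : Measure Ω} [IsProbabilityMeasure P] {A S : W → Set Ω} {a : ℝ} {p : W → ℝ}
    (hA : ∀ w, MeasurableSet (A w)) (hS : ∀ w, MeasurableSet (S w))
    (h1 : ∀ w, P.real (A w ∩ S w) = a * p w)
    (h2 : ∀ w w', w ≠ w' → P.real (A w ∩ (S w ∩ S w')) ≤ a * (p w * p w'))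
    (ha : 0 ≤ a) (hp : ∀ w, 0 ≤ p w) :
    a * ((∑ w, p w) * (1 - ∑ w, p w)) ≤ P.real (⋃ w, A w ∩ S w) := by
  classical
  -- Removing `B w` from `A w ∩ S w` makes these sets pairwise disjoint.
  let B : W → Set Ω := fun w => ⋃ w' ∈ Finset.univ.erase w, A w ∩ (S w ∩ S w')
  have mB : ∀ w, MeasurableSet (B w) := fun w =>
    Finset.measurableSet_biUnion _ fun w' _ => (hA w).inter ((hS w).inter (hS w'))
  have hB : ∀ w, P.real (B w) ≤ a * (p w * ∑ w', p w') := fun w =>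
    calc P.real (B w) ≤ ∑ w' ∈ Finset.univ.erase w, P.real (A w ∩ (S w ∩ S w')) :=
          measureReal_biUnion_finset_le _ _
      _ ≤ ∑ w' ∈ Finset.univ.erase w, a * (p w * p w') :=
          Finset.sum_le_sum fun w' hw' => h2 _ _ (Finset.ne_of_mem_erase hw').symm
      _ ≤ ∑ w', a * (p w * p w') :=
          Finset.sum_le_sum_of_subset_of_nonneg (Finset.subset_univ _) fun w' _ _ =>
            mul_nonneg ha (mul_nonneg (hp _) (hp _))
      _ = _ := by rw [Finset.mul_sum, Finset.mul_sum]
  calc a * ((∑ w, p w) * (1 - ∑ w, p w)) = ∑ w, (a * p w - a * (p w * ∑ w', p w')) := by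
        rw [Finset.sum_sub_distrib, ← Finset.mul_sum, ← Finset.mul_sum, ← Finset.sum_mul]
        ring
    _ ≤ ∑ w, P.real ((A w ∩ S w) \ B w) := Finset.sum_le_sum fun w _ => by
        have := le_measureReal_sdiff (μ := P) (s₁ := A w ∩ S w) (s₂ := B w)
          (measure_ne_top _ _)
        linarith [h1 w, hB w]
    _ = P.real (⋃ w ∈ Finset.univ, (A w ∩ S w) \ B w) := by
        rw [measureReal_biUnion_finset]
        · intro w _ w' _ hne
          simp only [Function.onFun]
          rw [Set.disjoint_left]
          rintro x ⟨⟨hx1, hx2⟩, hx3⟩ ⟨⟨-, hx4⟩, -⟩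
          exact hx3 (Set.mem_biUnion (Finset.mem_coe.2 (Finset.mem_erase.2
            ⟨hne.symm, Finset.mem_univ _⟩)) ⟨hx1, hx2, hx4⟩)
        · exact fun w _ => ((hA w).inter (hS w)).diff (mB w)
    _ ≤ P.real (⋃ w, A w ∩ S w) := by
        refine measureReal_mono ?_
        simp only [Finset.mem_univ, Set.iUnion_true]
        exact Set.iUnion_mono fun w => Set.sdiff_subset

/-- The process started from the activation of `node i l`, observed every `N` generations and
forgetting the earlier particles at each observation, lasts for `n` observations. -/
def Spread (d N : ℕ) : ℕ → Fin (d + 1) → List (Fin d) → Set (Config d)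
  | 0, _, _ => Set.univ
  | n + 1, i, l => ⋃ w : Fin N → Fin d,
      {ω | Act ω N (descend i l w)} ∩ Spread d N n i (List.ofFn w ++ l)

lemma subtree_descend_subset {N : ℕ} (i : Fin (d + 1)) (l : List (Fin d)) (w : Fin N → Fin d) :
    subtree (descend i l w) ⊆ subtree (.node i l) := by
  refine subtree_subset ⟨by simp, ?_⟩
  rw [level_descend, Nat.add_sub_cancel_left, anc_descend]

lemma measurableSet_act_descend_level {N : ℕ} (i : Fin (d + 1)) (l : List (Fin d))
    (w : Fin N → Fin d) :
    MeasurableSet[sigmaOf {v | v.level < (Vertex.node i l).level + N}]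
      {ω | Act ω N (descend i l w)} :=
  measurableSet_act fun k hk hk' => by
    simp only [Set.mem_ofPred_eq, level_anc, level_descend]
    omega

lemma measurableSet_act_descend {N : ℕ} (i : Fin (d + 1)) (l : List (Fin d))
    (w : Fin N → Fin d) :
    MeasurableSet[sigmaOf (subtree (.node i l))] {ω | Act ω N (descend i l w)} :=
  measurableSet_act fun k hk hk' => by
    refine ⟨by rw [level_anc, level_descend]; omega, ?_⟩
    rw [anc_anc, level_anc, level_descend]
    convert anc_descend i l w using 2
    omega

lemma measurableSet_spread {N : ℕ} (n : ℕ) : ∀ (i : Fin (d + 1)) (l : List (Fin d)),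
    MeasurableSet[sigmaOf (subtree (.node i l))] (Spread d N n i l) := by
  induction n with
  | zero => exact fun i l => MeasurableSet.univ
  | succ n ih =>
    intro i l
    exact MeasurableSet.iUnion fun w => (measurableSet_act_descend i l w).inter
      (sigmaOf_mono (subtree_descend_subset i l w) _ (ih i _))

lemma exists_activatedAt_of_spread {N : ℕ} {ω : Config d} (n : ℕ) :
    ∀ {i : Fin (d + 1)} {l : List (Fin d)} {s : ℕ}, ω ∈ Spread d N n i l →
      ActivatedAt ω (.node i l) s → ∃ y, ActivatedAt ω y (s + n * N) := by
  induction n with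
  | zero => exact fun {i l s} _ h => ⟨_, by simpa using h⟩
  | succ n ih =>
    intro i l s hω h
    obtain ⟨w, hw, hw'⟩ := Set.mem_iUnion.1 hω
    have h1 : ActivatedAt ω (descend i l w) (s + N) :=
      Act.activatedAt hw (by rwa [anc_descend])
    obtain ⟨y, hy⟩ := ih hw' h1
    exact ⟨y, by convert hy using 1; ring⟩

lemma disjoint_level_subtree {x : Vertex d} {L : ℕ} (h : L ≤ x.level) :
    Disjoint {v | v.level < L} (subtree x) := by
  rw [Set.disjoint_left]
  rintro v hv ⟨hv', -⟩
  simp only [Set.mem_ofPred_eq] at hv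
  omega

variable [NeZero d] {ν : PMF ℕ} {c q : ℝ}

/-- There are `d ^ N` candidate descendants, each activated with probability `hitProb c q N`, and
later evolutions in their disjoint subtrees are independent. Induction on `n` propagates one lower
bound through the second-moment estimate. -/
lemma exists_le_real_spread (hν : IsLifetimeLaw d c q ν) (hq : 0 ≤ q) (hc : 0 ≤ c) {N : ℕ}
    (hN : 1 < d ^ N * hitProb c q N) :
    ∃ δ > 0, ∀ n i l, δ ≤ (frogMeasure d ν).real (Spread d N n i l) := by
  have hd : 0 < d := Nat.pos_of_ne_zero (NeZero.ne d)
  have hD : (1 : ℝ) ≤ (d : ℝ) ^ N := one_le_pow₀ (by exact_mod_cast hd)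
  set D : ℝ := (d : ℝ) ^ N with hDdef
  set a := hitProb c q N with ha
  have hA : ∀ i l (w : Fin N → Fin d),
      (frogMeasure d ν).real {ω | Act ω N (descend i l w)} = a := fun i l w =>
    real_act_eq hν hq hc (by rw [level_descend, Vertex.level]; omega)
  have ha1 : a ≤ 1 := by
    rw [← hA 0 [] fun _ => ⟨0, hd⟩]
    exact measureReal_le_one
  have ha0 : 0 < a := by
    by_contra h
    push Not at h
    nlinarith
  -- This choice makes `a * δ` reproduce itself exactly under the Bonferroni bound; `δ` is positive
  -- because `D * a > 1`.
  obtain ⟨δ, hδ, hDδ⟩ : ∃ δ, 0 < δ ∧ D * a * (1 - D * δ) = 1 := by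
    refine ⟨(1 - 1 / (D * a)) / D, div_pos (sub_pos.2 ?_) (by linarith), by field_simp; ring⟩
    rwa [div_lt_one (by linarith)]
  have hδ1 : δ ≤ 1 := by
    have h1 : 0 < 1 - D * δ := by
      by_contra h
      push Not at h
      nlinarith [mul_pos (zero_lt_one.trans_le hD) ha0]
    nlinarith
  refine ⟨a * δ, by positivity, fun n => ?_⟩
  induction n with
  | zero =>
    intro i l
    simp only [Spread, probReal_univ]
    nlinarith
  | succ n ih =>
    intro i l
    set p : (Fin N → Fin d) → ℝ := fun w =>
      (frogMeasure d ν).real (Spread d N n i (List.ofFn w ++ l)) with hp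
    have mA : ∀ w : Fin N → Fin d,
      MeasurableSet[sigmaOf {v | v.level < (Vertex.node i l).level + N}]
        {ω | Act ω N (descend i l w)} := measurableSet_act_descend_level i l
    have mS : ∀ w : Fin N → Fin d, MeasurableSet[sigmaOf (subtree (descend i l w))]
        (Spread d N n i (List.ofFn w ++ l)) := fun w => measurableSet_spread n i _
    have h1 : ∀ w, (frogMeasure d ν).real ({ω | Act ω N (descend i l w)} ∩
        Spread d N n i (List.ofFn w ++ l)) = a * p w := fun w => by
      rw [real_inter_of_disjoint (disjoint_level_subtree (by simp)) (mA w) (mS w), hA]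
    -- If one subtree has probability above `δ`, it suffices alone. Otherwise the sum of the `p w`
    -- is at most `D * δ < 1`, which keeps the Bonferroni bound effective.
    by_cases hex : ∃ w, δ < p w
    · obtain ⟨w, hw⟩ := hex
      calc a * δ ≤ a * p w := by gcongr
        _ = _ := (h1 w).symm
        _ ≤ _ := measureReal_mono (Set.subset_iUnion_of_subset w subset_rfl)
    · push Not at hex
      have h2 : ∀ w w', w ≠ w' → (frogMeasure d ν).real ({ω | Act ω N (descend i l w)} ∩
          (Spread d N n i (List.ofFn w ++ l) ∩ Spread d N n i (List.ofFn w' ++ l))) ≤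
            a * (p w * p w') := fun w w' hne => by
        rw [real_inter_of_disjoint
          (T := subtree (descend i l w) ∪ subtree (descend i l w')) ?_ (mA w) ?_,
          real_inter_of_disjoint (disjoint_subtree (by simp)
            ((descend_injective i l).ne hne)) (mS w) (mS w'), hA]
        · exact (disjoint_level_subtree (by simp)).union_right (disjoint_level_subtree (by simp))
        · exact (sigmaOf_mono Set.subset_union_left _ (mS w)).inter
            (sigmaOf_mono Set.subset_union_right _ (mS w'))
      have h3 := le_measureReal_iUnion_inter (fun w => sigmaOf_le _ _ (mA w))
        (fun w => sigmaOf_le _ _ (mS w)) h1 h2 ha0.le fun w => measureReal_nonneg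
      refine le_trans ?_ h3
      have hcard : ((Finset.univ : Finset (Fin N → Fin d)).card : ℝ) = D := by
        simp [hDdef]
      have hlow : D * (a * δ) ≤ ∑ w, p w := by
        have := Finset.card_nsmul_le_sum Finset.univ p (a * δ) fun w _ => ih i _
        rwa [nsmul_eq_mul, hcard] at this
      have hup : ∑ w, p w ≤ D * δ := by
        have := Finset.sum_le_card_nsmul Finset.univ p δ fun w _ => hex w
        rwa [nsmul_eq_mul, hcard] at this
      have hpos : 0 < 1 - D * δ := by
        by_contra h
        push Not at h
        nlinarith [mul_pos (zero_lt_one.trans_le hD) ha0]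
      calc a * δ = a * (D * (a * δ) * (1 - D * δ)) := by linear_combination (-(a * δ)) * hDδ
        _ ≤ a * ((∑ w, p w) * (1 - ∑ w, p w)) := by gcongr

end Growth

/-! ### Survival and extinction from the size of `d ^ n * hitProb c q n`. -/

section Survival

variable {d : ℕ}

lemma measurableSet_exists_activatedAt (t : ℕ) :
    MeasurableSet {ω : Config d | ∃ y, ActivatedAt ω y t} := by
  have : {ω : Config d | ∃ y, ActivatedAt ω y t} =
      ⋃ y : Vertex d, {_ω : Config d | y.level = t} ∩ {ω | Act ω t y} := by
    ext ω
    simp [activatedAt_iff]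
  rw [this]
  exact MeasurableSet.iUnion fun y => (MeasurableSet.const _).inter
    (sigmaOf_le Set.univ _ (measurableSet_act fun _ _ _ => Set.mem_univ _))

variable [NeZero d] {ν : PMF ℕ} {c q : ℝ}

lemma survivalProb_le (t : ℕ) :
    survivalProb d ν ≤ frogMeasure d ν {ω | ∃ y, ActivatedAt ω y t} :=
  measure_mono fun _ h => survives_iff.1 h t

lemma le_survivalProb {N : ℕ} (hN : 1 ≤ N) {ε : ℝ≥0∞}
    (h : ∀ n, ε ≤ frogMeasure d ν {ω | ∃ y, ActivatedAt ω y (1 + n * N)}) :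
    ε ≤ survivalProb d ν := by
  have e : {ω : Config d | Survives ω} = ⋂ t, {ω | ∃ y, ActivatedAt ω y t} := by
    ext ω
    simp [survives_iff]
  have hanti : Antitone fun t => {ω : Config d | ∃ y, ActivatedAt ω y t} :=
    fun s t hst ω hω => exists_activatedAt_of_le hst hω
  rw [survivalProb, e, hanti.measure_iInter
    (fun t => (measurableSet_exists_activatedAt t).nullMeasurableSet) ⟨0, measure_ne_top _ _⟩]
  refine le_iInf fun t => (h t).trans (measure_mono (hanti ?_))
  nlinarith

lemma survivalProb_pos (hν : IsLifetimeLaw d c q ν) (hq : 0 < q) (hc : 0 < c) {N : ℕ}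
    (hN1 : 1 ≤ N) (hN : 1 < d ^ N * hitProb c q N) : 0 < survivalProb d ν := by
  obtain ⟨δ, hδ, h⟩ := exists_le_real_spread hν hq.le hc.le hN
  -- Starting from a child of the root avoids the exceptional first step; activating it costs a
  -- positive factor.
  set x : Vertex d := .node 0 []
  have hr := real_reach_one_pos hν hq hc (y := x) rfl
  refine lt_of_lt_of_le (ENNReal.ofReal_pos.2 (mul_pos hr hδ)) (le_survivalProb hN1 fun n => ?_)
  refine ENNReal.ofReal_le_of_le_toReal ?_
  calc (frogMeasure d ν).real {ω | Reach ω x 1} * δ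
      ≤ (frogMeasure d ν).real {ω | Reach ω x 1} * (frogMeasure d ν).real (Spread d N n 0 []) := by
        gcongr
        exact h n _ _
    _ = (frogMeasure d ν).real ({ω | Reach ω x 1} ∩ Spread d N n 0 []) :=
        (real_inter_of_disjoint (disjoint_level_subtree (L := 1) (x := x) (by simp [x, Vertex.level]))
          (measurableSet_reach (by rw [Set.mem_ofPred_eq, level_anc]; simp [x, Vertex.level]))
          (measurableSet_spread n _ _)).symm
    _ ≤ (frogMeasure d ν).real {ω | ∃ y, ActivatedAt ω y (1 + n * N)} := by
        refine measureReal_mono ?_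
        rintro ω ⟨hω, hω'⟩
        refine exists_activatedAt_of_spread n hω' (activatedAt_iff.2 ⟨rfl, ?_⟩)
        exact act_of_reach le_rfl (fun j hj => by omega) hω

/-- First-moment bound over the `(d + 1) * d ^ n` vertices at this distance. -/
lemma real_exists_activatedAt_le (hν : IsLifetimeLaw d c q ν) (hq : 0 ≤ q) (hc : 0 ≤ c) (n : ℕ) :
    (frogMeasure d ν).real {ω | ∃ y, ActivatedAt ω y (n + 1)} ≤
      (d + 1) * d ^ n * hitProb c q (n + 1) := by
  calc (frogMeasure d ν).real {ω | ∃ y, ActivatedAt ω y (n + 1)}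
      ≤ (frogMeasure d ν).real (⋃ z : Fin (d + 1) × (Fin n → Fin d),
          {ω | Act ω (n + 1) (.node z.1 (List.ofFn z.2))}) := by
        refine measureReal_mono ?_
        rintro ω ⟨y, hy⟩
        obtain ⟨i, w, rfl⟩ := exists_eq_node_of_level hy.level_eq
        exact Set.mem_iUnion.2 ⟨(i, w), hy.act⟩
    _ ≤ ∑ z : Fin (d + 1) × (Fin n → Fin d),
          (frogMeasure d ν).real {ω | Act ω (n + 1) (.node z.1 (List.ofFn z.2))} :=
        measureReal_iUnion_fintype_le _
    _ ≤ ∑ _z : Fin (d + 1) × (Fin n → Fin d), hitProb c q (n + 1) :=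
        Finset.sum_le_sum fun z _ => real_act_le hν hq hc (by simp [Vertex.level])
    _ = _ := by simp

lemma survivalProb_eq_zero (hν : IsLifetimeLaw d c q ν) (hq : 0 ≤ q) (hc : 0 ≤ c)
    (h : Filter.Tendsto (fun n => (d : ℝ) ^ n * hitProb c q n) Filter.atTop (nhds 0)) :
    survivalProb d ν = 0 := by
  have hd : (0 : ℝ) < d := by exact_mod_cast Nat.pos_of_ne_zero (NeZero.ne d)
  have h1 : Filter.Tendsto (fun n => (d + 1 : ℝ) * d ^ n * hitProb c q (n + 1))
      Filter.atTop (nhds 0) := by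
    have h2 := ((Filter.tendsto_add_atTop_iff_nat 1).2 h).const_mul ((d + 1 : ℝ) / d)
    rw [mul_zero] at h2
    refine h2.congr fun n => ?_
    field_simp
    ring
  have h3 : (survivalProb d ν).toReal ≤ 0 := ge_of_tendsto' h1 fun n =>
    (ENNReal.toReal_mono (measure_ne_top _ _) (survivalProb_le (n + 1))).trans
      (real_exists_activatedAt_le hν hq hc n)
  exact ((ENNReal.toReal_eq_zero_iff _).1 (h3.antisymm ENNReal.toReal_nonneg)).resolve_right
    (measure_ne_top _ _)

end Survival

/-! ### Deterministic renewal sequences with defective or excessive increments. -/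

section RenewalSequence

variable {u t : ℕ → ℝ}

/-- Summing the recursion bounds each partial sum `U` by `1 + F * U`, where `F < 1` is the total
increment. -/
lemma summable_of_renewal (hu0 : u 0 = 1)
    (hu : ∀ n, u (n + 1) = ∑ k ∈ Finset.range (n + 1), u (n - k) * t k)
    (hpos : ∀ n, 0 ≤ u n) (ht : ∀ k, 0 ≤ t k) (hs : Summable t) (hlt : ∑' k, t k < 1) :
    Summable u := by
  set F := ∑' k, t k with hF
  refine summable_of_sum_range_le (c := 1 / (1 - F)) hpos fun n => ?_
  set U := ∑ i ∈ Finset.range n, u i with hU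
  have h1 : ∑ i ∈ Finset.range n, u (i + 1) ≤ F * U := by
    calc ∑ i ∈ Finset.range n, u (i + 1)
        = ∑ i ∈ Finset.range n, ∑ k ∈ Finset.range (i + 1), t k * u (i - k) := by
          refine Finset.sum_congr rfl fun i _ => ?_
          rw [hu]
          exact Finset.sum_congr rfl fun k _ => mul_comm _ _
      _ = ∑ k ∈ Finset.range n, ∑ i ∈ Finset.range (n - k), t k * u i :=
          Finset.sum_range_diag_flip n fun k i => t k * u i
      _ ≤ ∑ k ∈ Finset.range n, t k * U := by
          refine Finset.sum_le_sum fun k _ => ?_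
          rw [← Finset.mul_sum]
          refine mul_le_mul_of_nonneg_left ?_ (ht k)
          exact Finset.sum_le_sum_of_subset_of_nonneg
            (Finset.range_mono (Nat.sub_le n k)) fun i _ _ => hpos i
      _ = (∑ k ∈ Finset.range n, t k) * U := by rw [Finset.sum_mul]
      _ ≤ F * U := mul_le_mul_of_nonneg_right (hs.sum_le_tsum _ fun k _ => ht k)
          (Finset.sum_nonneg fun i _ => hpos i)
  have h2 : U ≤ ∑ i ∈ Finset.range n, u (i + 1) + 1 := by
    rw [← hu0, ← Finset.sum_range_succ', Finset.sum_range_succ]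
    linarith [hpos n]
  rw [le_div_iff₀ (by linarith)]
  linarith

/-- With finitely many increments of total `F > 1`, a lower bound on `K` consecutive values improves
by the factor `F` at the next one, which forces geometric growth. -/
lemma exists_one_lt_of_renewal
    (hu : ∀ n, u (n + 1) = ∑ k ∈ Finset.range (n + 1), u (n - k) * t k)
    (hpos : ∀ n, 0 < u n) (ht : ∀ k, 0 ≤ t k) {K : ℕ}
    (hK : 1 < ∑ k ∈ Finset.range K, t k) : ∃ N, 1 ≤ N ∧ 1 < u N := by
  set F := ∑ k ∈ Finset.range K, t k with hF
  have hK1 : 1 ≤ K := by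
    by_contra h
    obtain rfl : K = 0 := by omega
    simp [hF] at hK
    linarith
  obtain ⟨r, hr, hrle⟩ : ∃ r > 0, ∀ i < K, r ≤ u i := by
    have hne : (Finset.range K).Nonempty := Finset.nonempty_range_iff.2 (by omega)
    obtain ⟨i, -, hi⟩ := Finset.exists_min_image (Finset.range K) u hne
    exact ⟨u i, hpos i, fun j hj => hi j (Finset.mem_range.2 hj)⟩
  have hstep : ∀ (x : ℝ) (n : ℕ), K ≤ n + 1 → (∀ k < K, x ≤ u (n - k)) → F * x ≤ u (n + 1) := by
    intro x n hn hx
    rw [hu]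
    calc F * x = ∑ k ∈ Finset.range K, t k * x := by rw [hF, Finset.sum_mul]
      _ ≤ ∑ k ∈ Finset.range K, u (n - k) * t k := by
          refine Finset.sum_le_sum fun k hk => ?_
          rw [mul_comm]
          exact mul_le_mul_of_nonneg_right (hx k (Finset.mem_range.1 hk)) (ht k)
      _ ≤ _ := Finset.sum_le_sum_of_subset_of_nonneg (Finset.range_mono hn) fun k _ _ =>
          mul_nonneg (hpos _).le (ht k)
  have hbase : ∀ n, r ≤ u n := by
    intro n
    induction n using Nat.strong_induction_on with
    | _ n ih =>
      rcases lt_or_ge n K with h | h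
      · exact hrle n h
      · obtain ⟨n, rfl⟩ : ∃ i, n = i + 1 := ⟨n - 1, by omega⟩
        have := hstep r n h fun k _ => ih _ (by omega)
        nlinarith
  have hgrow : ∀ j n, j * K ≤ n → F ^ j * r ≤ u n := by
    intro j
    induction j with
    | zero => intro n _; simpa using hbase n
    | succ j ih =>
      intro n hn
      rw [Nat.succ_mul] at hn
      obtain ⟨n, rfl⟩ : ∃ i, n = i + 1 := ⟨n - 1, by omega⟩
      have := hstep (F ^ j * r) n (by omega) fun k hk => ih _ (by omega)
      rwa [pow_succ', mul_assoc]
  obtain ⟨j, hj⟩ := pow_unbounded_of_one_lt (1 / r) hK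
  rw [div_lt_iff₀ hr] at hj
  exact ⟨j * K + 1, by omega, hj.trans_le (hgrow j _ (by omega))⟩

end RenewalSequence

/-! ### Convergence, monotonicity and continuity of the series. -/

section Series

/-- The terms of the series that determines the critical parameter. -/
def seriesTerm (d : ℕ) (c q : ℝ) (k : ℕ) : ℝ :=
  c * (d * q) ^ (k + 1) * ∏ i ∈ Finset.Icc 1 k, (1 - c * q ^ i)

variable {d : ℕ} {c q : ℝ}

lemma seriesTerm_eq (d : ℕ) (c q : ℝ) (k : ℕ) :
    seriesTerm d c q k = d ^ (k + 1) * gapProb c q k := by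
  rw [seriesTerm, gapProb]
  ring

lemma prod_one_sub_pos (hc : c ∈ Set.Ioc (0 : ℝ) 1) (hq : q ∈ Set.Ico (0 : ℝ) 1) (k : ℕ) :
    0 < ∏ i ∈ Finset.Icc 1 k, (1 - c * q ^ i) := by
  refine Finset.prod_pos fun i hi => ?_
  have h1 : q ^ i < 1 := pow_lt_one₀ hq.1 hq.2 (by have := (Finset.mem_Icc.1 hi).1; omega)
  nlinarith [hc.1, hc.2, pow_nonneg hq.1 i]

lemma prod_one_sub_le_one (hc : c ∈ Set.Ioc (0 : ℝ) 1) (hq : q ∈ Set.Ico (0 : ℝ) 1) (k : ℕ) :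
    ∏ i ∈ Finset.Icc 1 k, (1 - c * q ^ i) ≤ 1 := by
  refine Finset.prod_le_one (fun i hi => ?_) fun i hi => ?_
  · have h1 : q ^ i ≤ 1 := pow_le_one₀ hq.1 hq.2.le
    nlinarith [hc.1, hc.2, pow_nonneg hq.1 i]
  · have := mul_nonneg hc.1.le (pow_nonneg hq.1 i)
    linarith

lemma seriesTerm_nonneg (hc : c ∈ Set.Ioc (0 : ℝ) 1) (hq : q ∈ Set.Ico (0 : ℝ) 1) (k : ℕ) :
    0 ≤ seriesTerm d c q k := by
  have := prod_one_sub_pos hc hq k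
  have := hc.1
  have := hq.1
  unfold seriesTerm
  positivity

lemma seriesTerm_le (hc : c ∈ Set.Ioc (0 : ℝ) 1) (hq : q ∈ Set.Ico (0 : ℝ) 1) (k : ℕ) :
    seriesTerm d c q k ≤ (d * q) ^ (k + 1) := by
  have h1 := prod_one_sub_pos hc hq k
  have h2 := prod_one_sub_le_one hc hq k
  have h3 : 0 ≤ (d * q) ^ (k + 1) := pow_nonneg (mul_nonneg (Nat.cast_nonneg d) hq.1) _
  unfold seriesTerm
  calc c * (d * q) ^ (k + 1) * ∏ i ∈ Finset.Icc 1 k, (1 - c * q ^ i)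
      ≤ 1 * (d * q) ^ (k + 1) * 1 := by
        gcongr
        exact hc.2
    _ = _ := by ring

lemma gapProb_pos (hc : c ∈ Set.Ioc (0 : ℝ) 1) (hq : q ∈ Set.Ioo (0 : ℝ) 1) (k : ℕ) :
    0 < gapProb c q k := by
  have := prod_one_sub_pos hc ⟨hq.1.le, hq.2⟩ k
  have := hc.1
  have := hq.1
  unfold gapProb
  positivity

lemma hitProb_pos (hc : c ∈ Set.Ioc (0 : ℝ) 1) (hq : q ∈ Set.Ioo (0 : ℝ) 1) (n : ℕ) :
    0 < hitProb c q n := by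
  induction n using Nat.strong_induction_on with
  | _ n ih =>
    rcases n with _ | n
    · simp [hitProb_zero]
    rw [hitProb_succ]
    exact Finset.sum_pos (fun k _ => mul_pos (ih _ (by omega)) (gapProb_pos hc hq k))
      (Finset.nonempty_range_iff.2 (by omega))

lemma pow_mul_hitProb_succ (d : ℕ) (c q : ℝ) (n : ℕ) :
    (d : ℝ) ^ (n + 1) * hitProb c q (n + 1) =
      ∑ k ∈ Finset.range (n + 1), (d ^ (n - k) * hitProb c q (n - k)) * seriesTerm d c q k := by
  rw [hitProb_succ, Finset.mul_sum]
  refine Finset.sum_congr rfl fun k hk => ?_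
  rw [Finset.mem_range] at hk
  rw [seriesTerm_eq, show n + 1 = (n - k) + (k + 1) by omega, pow_add]
  ring

lemma summable_seriesTerm (hc : c ∈ Set.Ioc (0 : ℝ) 1) (hq : q ∈ Set.Ico (0 : ℝ) 1)
    (hdq : d * q < 1) : Summable (seriesTerm d c q) := by
  refine Summable.of_nonneg_of_le (seriesTerm_nonneg hc hq) (seriesTerm_le hc hq) ?_
  exact (summable_nat_add_iff 1).2
    (summable_geometric_of_lt_one (mul_nonneg (Nat.cast_nonneg d) hq.1) hdq)

/-- The infinite product is positive since `∑ q ^ i` converges: beyond some `M`, the product loses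
at most half of its value. -/
lemma exists_le_prod_one_sub (hc : c ∈ Set.Ioc (0 : ℝ) 1) (hq : q ∈ Set.Ioo (0 : ℝ) 1) :
    ∃ ε > 0, ∀ k, ε ≤ ∏ i ∈ Finset.Icc 1 k, (1 - c * q ^ i) := by
  have hq' : q ∈ Set.Ico (0 : ℝ) 1 := ⟨hq.1.le, hq.2⟩
  have h1q : 0 < 1 - q := by linarith [hq.2]
  set P : ℕ → ℝ := fun k => ∏ i ∈ Finset.Icc 1 k, (1 - c * q ^ i) with hP
  have hPpos : ∀ k, 0 < P k := prod_one_sub_pos hc hq'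
  have hPs : ∀ k, P (k + 1) = P k * (1 - c * q ^ (k + 1)) := fun k =>
    Finset.prod_Icc_succ_top (by omega) _
  have hanti : Antitone P := antitone_nat_of_succ_le fun k => by
    rw [hPs]
    have := mul_pos (hPpos k) (mul_pos hc.1 (pow_pos hq.1 (k + 1)))
    linarith
  obtain ⟨M, hM⟩ := exists_pow_lt_of_lt_one (show 0 < (1 - q) / 2 by linarith) hq.2
  have key : ∀ j, P M * (1 - ∑ i ∈ Finset.range j, q ^ (M + i)) ≤ P (M + j) := by
    intro j
    induction j with
    | zero => simp
    | succ j ih =>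
      rw [Finset.sum_range_succ, ← add_assoc, hPs]
      have h2 : c * q ^ (M + j + 1) ≤ q ^ (M + j) := by
        rw [pow_succ]
        have := pow_pos hq.1 (M + j)
        have : c * q ≤ 1 := by nlinarith [hc.1, hc.2, hq.1, hq.2]
        nlinarith
      have h3 : P (M + j) ≤ P M := hanti (Nat.le_add_right M j)
      have h4 := hPpos (M + j)
      have h5 := mul_le_mul_of_nonneg_left h2 h4.le
      have h6 := mul_le_mul_of_nonneg_right h3 (pow_pos hq.1 (M + j)).le
      linarith
  have hsum : ∀ j, ∑ i ∈ Finset.range j, q ^ (M + i) ≤ 1 / 2 := by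
    intro j
    calc ∑ i ∈ Finset.range j, q ^ (M + i) = q ^ M * ∑ i ∈ Finset.range j, q ^ i := by
          rw [Finset.mul_sum]
          exact Finset.sum_congr rfl fun i _ => pow_add _ _ _
      _ ≤ q ^ M * (1 - q)⁻¹ := by
          have := pow_pos hq.1 M
          gcongr
          rw [← tsum_geometric_of_lt_one hq.1.le hq.2]
          exact (summable_geometric_of_lt_one hq.1.le hq.2).sum_le_tsum _
            fun i _ => (pow_pos hq.1 i).le
      _ ≤ (1 - q) / 2 * (1 - q)⁻¹ := by gcongr
      _ = 1 / 2 := by field_simp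
  refine ⟨P M * (1 / 2), by have := hPpos M; positivity, fun k => ?_⟩
  have h7 := key k
  have h8 := hanti (Nat.le_add_left k M)
  have h9 := mul_le_mul_of_nonneg_left (hsum k) (hPpos M).le
  linarith

lemma exists_le_seriesTerm (hc : c ∈ Set.Ioc (0 : ℝ) 1) (hq : q ∈ Set.Ioo (0 : ℝ) 1)
    (hdq : 1 ≤ d * q) : ∃ ε > 0, ∀ k, ε ≤ seriesTerm d c q k := by
  obtain ⟨ε, hε, h⟩ := exists_le_prod_one_sub hc hq
  have hc0 := hc.1
  refine ⟨c * 1 * ε, by positivity, fun k => ?_⟩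
  unfold seriesTerm
  gcongr
  · exact one_le_pow₀ hdq
  · exact h k

lemma not_summable_seriesTerm (hc : c ∈ Set.Ioc (0 : ℝ) 1) (hq : q ∈ Set.Ioo (0 : ℝ) 1)
    (hdq : 1 ≤ d * q) : ¬ Summable (seriesTerm d c q) := by
  intro hs
  obtain ⟨ε, hε, h⟩ := exists_le_seriesTerm hc hq hdq
  exact absurd (ge_of_tendsto' hs.tendsto_atTop_zero h) (not_le.2 hε)

/-- On `[0, 1/2]` the map `x ↦ x ^ (i + 1)` has Lipschitz constant at most `(i + 1) / 2 ^ i ≤ 1`, so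
the linear term dominates. -/
lemma mul_one_sub_le (hc : c ∈ Set.Ioc (0 : ℝ) 1) {x y : ℝ} (hx : 0 ≤ x) (hxy : x ≤ y)
    (hy : y ≤ 1 / 2) (i : ℕ) : x * (1 - c * x ^ i) ≤ y * (1 - c * y ^ i) := by
  have hy0 : 0 ≤ y := hx.trans hxy
  have h1 : y ^ (i + 1) - x ^ (i + 1) ≤ y - x := by
    rw [← Commute.geom_sum₂_mul (Commute.all y x) (i + 1)]
    have h2 : ∑ j ∈ Finset.range (i + 1), y ^ j * x ^ (i + 1 - 1 - j) ≤ 1 := by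
      calc ∑ j ∈ Finset.range (i + 1), y ^ j * x ^ (i + 1 - 1 - j)
          ≤ ∑ _j ∈ Finset.range (i + 1), (1 / 2 : ℝ) ^ i := by
            refine Finset.sum_le_sum fun j hj => ?_
            rw [Finset.mem_range] at hj
            calc y ^ j * x ^ (i + 1 - 1 - j) ≤ y ^ j * y ^ (i + 1 - 1 - j) := by gcongr
              _ = y ^ i := by rw [← pow_add]; congr 1; omega
              _ ≤ (1 / 2) ^ i := by gcongr
        _ = (i + 1) / 2 ^ i := by simp [div_eq_mul_inv]
        _ ≤ 1 := by
            rw [div_le_one (by positivity)]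
            exact_mod_cast Nat.lt_two_pow_self
    nlinarith
  have h3 : x ^ (i + 1) ≤ y ^ (i + 1) := by gcongr
  have h4 : c * (y ^ (i + 1) - x ^ (i + 1)) ≤ 1 * (y ^ (i + 1) - x ^ (i + 1)) :=
    mul_le_mul_of_nonneg_right hc.2 (by linarith)
  rw [pow_succ, pow_succ] at *
  linarith

/-- The factors `1 - c * q ^ i` decrease in `q`; pairing each with one power of `q` makes every
factor nondecreasing on `[0, 1/2]`, which contains all `q ≥ 0` with `d * q < 1`. -/
lemma seriesTerm_eq_prod (d : ℕ) (c q : ℝ) (k : ℕ) :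
    seriesTerm d c q k = c * d ^ (k + 1) * (q * ∏ i ∈ Finset.Icc 1 k, (q * (1 - c * q ^ i))) := by
  rw [seriesTerm, Finset.prod_mul_distrib, Finset.prod_const, Nat.card_Icc, Nat.add_sub_cancel]
  ring

lemma seriesTerm_mono (hc : c ∈ Set.Ioc (0 : ℝ) 1) {x y : ℝ} (hx : 0 ≤ x) (hxy : x ≤ y)
    (hy : y ≤ 1 / 2) (k : ℕ) : seriesTerm d c x k ≤ seriesTerm d c y k := by
  have hc0 := hc.1
  have h : ∀ i ∈ Finset.Icc 1 k, 0 ≤ x * (1 - c * x ^ i) := fun i _ => by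
    have : x ^ i ≤ 1 := pow_le_one₀ hx (by linarith)
    exact mul_nonneg hx (by nlinarith [hc.2, pow_nonneg hx i])
  rw [seriesTerm_eq_prod, seriesTerm_eq_prod]
  refine mul_le_mul_of_nonneg_left (mul_le_mul hxy ?_ (Finset.prod_nonneg h) (hx.trans hxy))
    (by positivity)
  exact Finset.prod_le_prod h fun i _ => mul_one_sub_le hc hx hxy hy i

lemma mem_Ico_of_mul_lt_one (hd : 2 ≤ d) (hq : 0 ≤ q) (hdq : d * q < 1) :
    q ≤ 1 / 2 ∧ q ∈ Set.Ico (0 : ℝ) 1 := by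
  have : (2 : ℝ) ≤ d := by exact_mod_cast hd
  have h2 : q ≤ 1 / 2 := by nlinarith
  exact ⟨h2, hq, by linarith⟩

lemma tsum_seriesTerm_lt (hd : 2 ≤ d) (hc : c ∈ Set.Ioc (0 : ℝ) 1) {x y : ℝ} (hx : 0 ≤ x)
    (hxy : x < y) (hdy : d * y < 1) : ∑' k, seriesTerm d c x k < ∑' k, seriesTerm d c y k := by
  have hd0 : (0 : ℝ) < d := by exact_mod_cast (by omega : 0 < d)
  have hdx : d * x < 1 := by nlinarith
  obtain ⟨hy2, hy'⟩ := mem_Ico_of_mul_lt_one hd (hx.trans hxy.le) hdy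
  obtain ⟨-, hx'⟩ := mem_Ico_of_mul_lt_one hd hx hdx
  refine Summable.tsum_lt_tsum (i := 0) (seriesTerm_mono hc hx hxy.le hy2) ?_
    (summable_seriesTerm hc hx' hdx) (summable_seriesTerm hc hy' hdy)
  have := mul_lt_mul_of_pos_left hxy (mul_pos hc.1 hd0)
  simp only [seriesTerm, zero_add, pow_one, Finset.Icc_eq_empty_of_lt zero_lt_one,
    Finset.prod_empty, mul_one]
  linarith

lemma continuous_seriesTerm (d : ℕ) (c : ℝ) (k : ℕ) : Continuous fun q => seriesTerm d c q k := by
  unfold seriesTerm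
  fun_prop

/-- At `1 / d` the terms are bounded away from zero, so a finite partial sum exceeds one there, and
by continuity also slightly to the left. -/
lemma exists_one_lt_tsum_seriesTerm (hd : 2 ≤ d) (hc : c ∈ Set.Ioc (0 : ℝ) 1) :
    ∃ x : ℝ, 0 < x ∧ d * x < 1 ∧ 1 < ∑' k, seriesTerm d c x k := by
  have hd2 : (2 : ℝ) ≤ d := by exact_mod_cast hd
  have hd0 : (0 : ℝ) < d := by linarith
  have hmem : (1 / d : ℝ) ∈ Set.Ioo (0 : ℝ) 1 := ⟨by positivity, by
    rw [div_lt_one hd0]; linarith⟩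
  obtain ⟨ε, hε, h⟩ := exists_le_seriesTerm (d := d) hc hmem (by field_simp; rfl)
  obtain ⟨K, hK⟩ := exists_nat_gt (1 / ε)
  rw [div_lt_iff₀ hε] at hK
  have hcont : Continuous fun q => ∑ k ∈ Finset.range K, seriesTerm d c q k :=
    continuous_finsetSum _ fun k _ => continuous_seriesTerm d c k
  have hgt : 1 < ∑ k ∈ Finset.range K, seriesTerm d c (1 / d) k := by
    have := Finset.card_nsmul_le_sum (Finset.range K) (seriesTerm d c (1 / d)) ε fun k _ => h k
    rw [nsmul_eq_mul, Finset.card_range] at this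
    linarith
  have hev : ∀ᶠ q in nhdsWithin (1 / d : ℝ) (Set.Iio (1 / d)),
      1 < ∑ k ∈ Finset.range K, seriesTerm d c q k :=
    nhdsWithin_le_nhds (hcont.continuousAt.eventually (lt_mem_nhds hgt))
  have hpos : ∀ᶠ q in nhdsWithin (1 / d : ℝ) (Set.Iio (1 / d)), 0 < q :=
    nhdsWithin_le_nhds (lt_mem_nhds hmem.1)
  obtain ⟨x, ⟨hx1, hx0⟩, hx⟩ := ((hev.and hpos).and self_mem_nhdsWithin).exists
  have hdx : d * x < 1 := by
    rw [lt_div_iff₀ hd0] at hx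
    linarith
  have hx' := (mem_Ico_of_mul_lt_one hd hx0.le hdx).2
  exact ⟨x, hx0, hdx, hx1.trans_le ((summable_seriesTerm hc hx' hdx).sum_le_tsum _
    fun k _ => seriesTerm_nonneg hc hx' k)⟩

lemma exists_tsum_seriesTerm_eq_one (hd : 2 ≤ d) (hc : c ∈ Set.Ioc (0 : ℝ) 1) :
    ∃ x : ℝ, 0 < x ∧ d * x < 1 ∧ ∑' k, seriesTerm d c x k = 1 := by
  have hd0 : (0 : ℝ) < d := by exact_mod_cast (by omega : 0 < d)
  obtain ⟨b, hb0, hdb, hb⟩ := exists_one_lt_tsum_seriesTerm hd hc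
  have hle : ∀ x ∈ Set.Icc 0 b, d * x < 1 := fun x hx => by nlinarith [hx.2]
  have hcont : ContinuousOn (fun x => ∑' k, seriesTerm d c x k) (Set.Icc 0 b) := by
    refine continuousOn_tsum (u := fun k => (d * b) ^ (k + 1))
      (fun k => (continuous_seriesTerm d c k).continuousOn) ?_ fun k x hx => ?_
    · exact (summable_nat_add_iff 1).2 (summable_geometric_of_lt_one (by positivity) hdb)
    · have hx' := (mem_Ico_of_mul_lt_one hd hx.1 (hle x hx)).2
      rw [Real.norm_of_nonneg (seriesTerm_nonneg hc hx' k)]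
      refine (seriesTerm_le hc hx' k).trans ?_
      have := hx.1
      have := hx.2
      gcongr
  have h0 : ∑' k, seriesTerm d c 0 k = 0 := by simp [seriesTerm]
  obtain ⟨x, hx, hx1⟩ := intermediate_value_Icc hb0.le hcont
    (show (1 : ℝ) ∈ Set.Icc _ _ from ⟨by simp [h0], hb.le⟩)
  refine ⟨x, lt_of_le_of_ne hx.1 ?_, hle x hx, hx1⟩
  rintro rfl
  simp [h0] at hx1

end Series

/-! ### Identification of the critical parameter. -/

section Critical

variable {d : ℕ} {c q : ℝ} {ν : PMF ℕ}

/-- The tails of a law on `ℕ` tend to zero, whereas `c * (d * q) ^ n ≥ c` if `d * q ≥ 1`. -/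
lemma mul_lt_one_of_isLifetimeLaw (hc : 0 < c) (hν : IsLifetimeLaw d c q ν) : d * q < 1 := by
  by_contra hle
  push Not at hle
  have hanti : Antitone fun n : ℕ => {m : ℕ | n ≤ m} := fun a b hab m hm => hab.trans hm
  have hlim := MeasureTheory.tendsto_measure_iInter_atTop (μ := ν.toMeasure)
    (fun n => (MeasurableSet.of_discrete (s := {m : ℕ | n ≤ m})).nullMeasurableSet) hanti
    ⟨0, MeasureTheory.measure_ne_top _ _⟩
  have he : ⋂ n : ℕ, {m : ℕ | n ≤ m} = ∅ := by
    ext m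
    simp only [Set.mem_iInter, Set.mem_ofPred_eq, Set.mem_empty_iff_false, iff_false, not_forall]
    exact ⟨m + 1, by omega⟩
  rw [he, MeasureTheory.measure_empty] at hlim
  have hge : ENNReal.ofReal c ≤ 0 := by
    refine ge_of_tendsto hlim ?_
    filter_upwards [Filter.eventually_ge_atTop 1] with n hn
    rw [Function.comp_apply, hν n hn]
    refine ENNReal.ofReal_le_ofReal ?_
    have := one_le_pow₀ (n := n) hle
    nlinarith
  exact absurd hge (not_le.2 (ENNReal.ofReal_pos.2 hc))

variable [NeZero d]

lemma survivalProb_eq_zero_of_tsum_lt (hd : 2 ≤ d) (hc : c ∈ Set.Ioc (0 : ℝ) 1)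
    (hν : IsLifetimeLaw d c q ν) (hq : 0 < q) (hdq : d * q < 1)
    (h : ∑' k, seriesTerm d c q k < 1) : survivalProb d ν = 0 := by
  have hq' := (mem_Ico_of_mul_lt_one hd hq.le hdq).2
  refine survivalProb_eq_zero hν hq.le hc.1.le (Summable.tendsto_atTop_zero ?_)
  refine summable_of_renewal (by simp [hitProb_zero]) (pow_mul_hitProb_succ d c q) (fun n => ?_)
    (seriesTerm_nonneg hc hq') (summable_seriesTerm hc hq' hdq) h
  have := hitProb_pos hc ⟨hq, hq'.2⟩ n
  positivity

lemma survivalProb_pos_of_lt_tsum (hd : 2 ≤ d) (hc : c ∈ Set.Ioc (0 : ℝ) 1)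
    (hν : IsLifetimeLaw d c q ν) (hq : 0 < q) (hdq : d * q < 1)
    (h : 1 < ∑' k, seriesTerm d c q k) : 0 < survivalProb d ν := by
  have hd0 : (0 : ℝ) < d := by exact_mod_cast (by omega : 0 < d)
  have hq' := (mem_Ico_of_mul_lt_one hd hq.le hdq).2
  obtain ⟨K, hK⟩ := ((summable_seriesTerm hc hq' hdq).hasSum.tendsto_sum_nat.eventually
    (lt_mem_nhds h)).exists
  obtain ⟨N, hN1, hN⟩ := exists_one_lt_of_renewal (pow_mul_hitProb_succ d c q)
    (fun n => mul_pos (pow_pos hd0 n) (hitProb_pos hc ⟨hq, hq'.2⟩ n)) (seriesTerm_nonneg hc hq') hK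
  exact survivalProb_pos hν hq hc.1 hN1 hN

lemma criticalParam_eq (hd : 2 ≤ d) (hc : c ∈ Set.Ioc (0 : ℝ) 1) (hq : 0 < q) (hdq : d * q < 1)
    (h : ∑' k, seriesTerm d c q k = 1) : criticalParam d c = q := by
  have hd0 : (0 : ℝ) < d := by exact_mod_cast (by omega : 0 < d)
  have hmem : ∀ x : ℝ, 0 < x → d * x < 1 → 1 < ∑' k, seriesTerm d c x k →
      x ∈ {q : ℝ | 0 < q ∧ q < 1 ∧ (∀ n : ℕ, 1 ≤ n → c * (d * q) ^ n < 1) ∧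
        ∃ ν : PMF ℕ, IsLifetimeLaw d c q ν ∧ 0 < survivalProb d ν} := by
    intro x hx0 hdx hx
    obtain ⟨ν, hν⟩ := exists_isLifetimeLaw hc.1 hc.2 (by positivity) hdx
    refine ⟨hx0, (mem_Ico_of_mul_lt_one hd hx0.le hdx).2.2, fun n hn => ?_, ν, hν,
      survivalProb_pos_of_lt_tsum hd hc hν hx0 hdx hx⟩
    have h1 : (d * x) ^ n < 1 := pow_lt_one₀ (by positivity) hdx (by omega)
    have h2 : 0 ≤ (d * x) ^ n := by positivity
    nlinarith [hc.1, hc.2]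
  refine csInf_eq_of_forall_ge_of_forall_gt_exists_lt ?_ ?_ ?_
  · obtain ⟨x, hx0, hdx, hx⟩ := exists_one_lt_tsum_seriesTerm hd hc
    exact ⟨x, hmem x hx0 hdx hx⟩
  · rintro x ⟨hx0, -, -, ν, hν, hpos⟩
    by_contra hlt
    push Not at hlt
    refine hpos.ne' (survivalProb_eq_zero_of_tsum_lt hd hc hν hx0
      (mul_lt_one_of_isLifetimeLaw hc.1 hν) ?_)
    rw [← h]
    exact tsum_seriesTerm_lt hd hc hx0.le hlt hdq
  · intro w hw
    -- The minimum with `1 / d` keeps `x` in the range where the lifetime law exists.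
    obtain ⟨x, hqx, hx⟩ := exists_between (lt_min hw ((lt_div_iff₀' hd0).2 hdq))
    have hdx : d * x < 1 := (lt_div_iff₀' hd0).1 (hx.trans_le (min_le_right _ _))
    refine ⟨x, hmem x (hq.trans hqx) hdx ?_, hx.trans_le (min_le_left _ _)⟩
    rw [← h]
    exact tsum_seriesTerm_lt hd hc hq.le hqx hdx

end Critical

end FrogModel

end

theorem theorem1 (d : ℕ) [NeZero d] (hd : 2 ≤ d) (c : ℝ) (hc : c ∈ Set.Ioc (0 : ℝ) 1) :
    HasSum (fun k : ℕ => c * (d * FrogModel.criticalParam d c) ^ (k + 1) *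
        ∏ i ∈ Finset.Icc 1 k, (1 - c * FrogModel.criticalParam d c ^ i)) 1 ∧
      (∀ q ∈ Set.Ioo (0 : ℝ) 1,
        HasSum (fun k : ℕ => c * (d * q) ^ (k + 1) *
          ∏ i ∈ Finset.Icc 1 k, (1 - c * q ^ i)) 1 → q = FrogModel.criticalParam d c) ∧
      FrogModel.criticalParam d c ∈ Set.Ioo (0 : ℝ) (1 / d) := by
  have hd0 : (0 : ℝ) < d := by exact_mod_cast (by omega : 0 < d)
  obtain ⟨x, hx0, hdx, hx⟩ := FrogModel.exists_tsum_seriesTerm_eq_one hd hc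
  rw [FrogModel.criticalParam_eq hd hc hx0 hdx hx]
  refine ⟨?_, fun q hq hs => ?_, hx0, (lt_div_iff₀' hd0).2 hdx⟩
  · have := (FrogModel.summable_seriesTerm hc
      (FrogModel.mem_Ico_of_mul_lt_one hd hx0.le hdx).2 hdx).hasSum
    rwa [hx] at this
  -- Convergence rules out `d * q ≥ 1`; any remaining solution is then the critical parameter
  -- itself.
  · have hdq : d * q < 1 := not_le.1 fun h =>
      FrogModel.not_summable_seriesTerm hc hq h hs.summable
    rw [← FrogModel.criticalParam_eq hd hc hx0 hdx hx]
    exact (FrogModel.criticalParam_eq hd hc hq.1 hdq hs.tsum_eq).symm
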